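/- Consider unoriented singular tangle diagrams in a disk, i.e. diagrams whose double points are ordinary crossings (with over/under information) or singular crossings (without), up to planar isotopy fixing the boundary of the disk. A local move $m$ replaces the content of a subdisk (its changing disk), and it may be performed in both directions; pictures that differ by planar isotopy, by a rotation of the changing disk or by exchanging the two sides of the move depict the same move. The unoriented singular Reidemeister moves are the following: - $\mathcal{R}\mathrm{I}^{\mathrm{un}}$: a curl with one ordinary crossing is created on or removed from a strand; - $\mathcal{R}\mathrm{II}^{\mathrm{un}}$: of two adjacent strands, one is pushed over the other, creating or removing two ordinary crossings; - $\mathcal{R}\mathrm{III}^{\mathrm{un}}$: of three strands lying at three different heights and forming a triangle with three ordinary crossings, one is pushed across the crossing of the two others; - $\mathcal{R}\mathrm{IV}_O^{\mathrm{un}}$ (resp. $\mathcal{R}\mathrm{IV}_U^{\mathrm{un}}$): a strand that passes over (resp. under) two strands meeting in a singular crossing is pushed across this singular crossing; - $\mathcal{R}\mathrm{V}^{\mathrm{un}}$: a singular crossing and an ordinary crossing that bound a bigon are exchanged, i.e. $\tau\sigma^{\pm1}\leftrightarrow\sigma^{\pm1}\tau$ for two vertical strands with a half twist $\sigma^{\pm1}$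 and a singular crossing $\tau$. Here all choices of over/under information and of the side on which a curl lies are allowed. A set $S$ of these moves is a generating set if each of these moves $m$ is generated by $S$, i.e. the change prescribed by $m$ can be achieved by a finite sequence of moves from $S$ and planar isotopies inside the changing disk of $m$, keeping its boundary fixed. A generating set $S$ is minimal if $S\setminus\{m\}$ is not a generating set for any $m\in S$. **Theorem.** A set $S$ of unoriented singular Reidemeister moves is a minimal generating set if and only if it contains exactly one move from each of $\mathcal{R}\mathrm{I}^{\mathrm{un}}$, $\mathcal{R}\mathrm{II}^{\mathrm{un}}$, $\mathcal{R}\mathrm{III}^{\mathrm{un}}$, $\mathcal{R}\mathrm{IV}_O^{\mathrm{un}}$, $\mathcal{R}\mathrm{IV}_U^{\mathrm{un}}$ and $\mathcal{R}\mathrm{V}^{\mathrm{un}}$. These six sets have $2$, $1$, $2$, $1$, $1$ and $2$ elements, respectively, so there are exactly $2\cdot1\cdot2\cdot1\cdot1\cdot2=8$ minimal generating sets. -/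

import Mathlib

/-!
Unoriented singular tangle diagrams in a disk, up to planar isotopy, and local moves on them.

The disk is drawn as a rectangle with `a` endpoints on its bottom side and `b` endpoints on its
top side.  A diagram in general position with respect to the height function is recorded, from
bottom to top, as the word of its elementary pieces: minima, maxima and double points.  Planar
isotopy rel boundary is the equivalence relation generated by the standard planar moves for such
words (exchange of the heights of two distant pieces, cancellation of a minimum against a maximum,
and sliding a strand's maximum or minimum through a double point).
-/

namespace SingularTangle

/-- The double points of a diagram.  Both strands are monotone in height; one of them runs from
the lower left to the upper right, the other one from the lower right to the upper left.
`above`: the strand from the lower left to the upper right is the upper strand.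
`below`: it is the lower strand.  `sing`: a singular crossing. -/
inductive Crossing
  | above
  | below
  | sing

/-- The effect of turning the plane by a right angle on a double point. -/
def Crossing.turn : Crossing → Crossing
  | .above => .below
  | .below => .above
  | .sing => .sing

/-- Elementary pieces: a minimum `∪`, a maximum `∩`, a double point. -/
inductive Piece
  | cup
  | cap
  | cross (c : Crossing)

/-- The number of strands entering a piece from below. -/
def Piece.dom : Piece → ℕ
  | .cup => 0
  | .cap => 2
  | .cross _ => 2

/-- The number of strands leaving a piece at its top. -/
def Piece.cod : Piece → ℕ
  | .cup => 2
  | .cap => 0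
  | .cross _ => 2

/-- A list of layers, from bottom to top.  The layer `(p, i)` consists of the piece `p` with `i`
vertical strands on its left (and any number of vertical strands on its right). -/
abbrev Word := List (Piece × ℕ)

/-- `IsDiagram a w b`: the layers of `w` fit on top of each other, starting with `a` strands at
the bottom and ending with `b` strands at the top. -/
def IsDiagram : ℕ → Word → ℕ → Prop
  | a, [], b => a = b
  | a, (p, i) :: w, b => ∃ r : ℕ, a = i + p.dom + r ∧ IsDiagram (i + p.cod + r) w b

/-- Singular tangle diagrams in a disk with `a` endpoints at the bottom and `b` at the top. -/
structure Diagram (a b : ℕ) where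
  word : Word
  valid : IsDiagram a word b

/-- Put `i` vertical strands on the left of a diagram. -/
def shift (i : ℕ) (w : Word) : Word := w.map fun x => (x.1, i + x.2)

/-- `Replaces L R D D'`: the diagram `D` contains a subdisk (with `i` strands on its left, `r`
strands on its right, `P` below and `Q` above) in which it agrees with `L`, and `D'` is the result
of replacing the content of this subdisk by `R`. -/
def Replaces {c d a b : ℕ} (L R : Diagram c d) (D D' : Diagram a b) : Prop :=
  ∃ (P Q : Word) (i r : ℕ),
    IsDiagram a P (i + c + r) ∧ IsDiagram (i + d + r) Q b ∧
    D.word = P ++ shift i L.word ++ Q ∧ D'.word = P ++ shift i R.word ++ Q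

/-- The local changes which generate planar isotopy. -/
inductive PlanarMove : {c d : ℕ} → Diagram c d → Diagram c d → Prop
  /-- The piece `p`, with `k` strands between it and the piece `q` on its right, is moved from
  below `q` to above `q`. -/
  | exchange (p q : Piece) (k : ℕ) :
      PlanarMove (c := p.dom + k + q.dom) (d := p.cod + k + q.cod)
        ⟨[(p, 0), (q, p.cod + k)],
          ⟨k + q.dom, by omega, 0, by omega, by simp [IsDiagram]⟩⟩
        ⟨[(q, p.dom + k), (p, 0)],
          ⟨0, by omega, k + q.cod, by omega, by simp [IsDiagram]; omega⟩⟩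
  | zigzagLeft :
      PlanarMove (c := 1) (d := 1)
        ⟨[(.cup, 1), (.cap, 0)], ⟨0, rfl, 1, rfl, rfl⟩⟩ ⟨[], rfl⟩
  | zigzagRight :
      PlanarMove (c := 1) (d := 1)
        ⟨[(.cup, 0), (.cap, 1)], ⟨1, rfl, 0, rfl, rfl⟩⟩ ⟨[], rfl⟩
  | slideCap (c : Crossing) :
      PlanarMove (c := 3) (d := 1)
        ⟨[(.cross c, 0), (.cap, 1)], ⟨1, rfl, 0, rfl, rfl⟩⟩
        ⟨[(.cross c.turn, 1), (.cap, 0)], ⟨0, rfl, 1, rfl, rfl⟩⟩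
  | slideCup (c : Crossing) :
      PlanarMove (c := 1) (d := 3)
        ⟨[(.cup, 1), (.cross c, 0)], ⟨0, rfl, 1, rfl, rfl⟩⟩
        ⟨[(.cup, 0), (.cross c.turn, 1)], ⟨1, rfl, 0, rfl, rfl⟩⟩

/-- Planar isotopy of diagrams in a disk, fixing the boundary of the disk. -/
def PlanarIsotopic {a b : ℕ} : Diagram a b → Diagram a b → Prop :=
  Relation.EqvGen fun D D' =>
    ∃ (c d : ℕ) (L R : Diagram c d), PlanarMove L R ∧ Replaces L R D D'

/-- A local move, as the relation "`D'` is obtained from `D` by performing the move once".  In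
particular, two pictures which differ by a rotation of the changing disk, by a planar isotopy
inside of it, or by exchanging the two sides, depict the same move. -/
abbrev LocalMove := ∀ a b : ℕ, Diagram a b → Diagram a b → Prop

/-- The local move `L ↔ R`: up to planar isotopy, the content of one changing disk is replaced,
either `L` by `R` or `R` by `L`. -/
def move {c d : ℕ} (L R : Diagram c d) : LocalMove := fun _ _ D D' =>
  ∃ E E', PlanarIsotopic D E ∧ (Replaces L R E E' ∨ Replaces R L E E') ∧ PlanarIsotopic E' D'

/-! ### The pictures of the unoriented singular Reidemeister moves -/

/-- `n` vertical strands. -/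
def vertical (n : ℕ) : Diagram n n := ⟨[], rfl⟩

/-- A strand with a curl on its right hand side. -/
def curlRight (c : Crossing) : Diagram 1 1 :=
  ⟨[(.cup, 1), (.cross c, 0), (.cap, 1)], ⟨0, rfl, 1, rfl, 0, rfl, rfl⟩⟩

/-- A strand with a curl on its left hand side. -/
def curlLeft (c : Crossing) : Diagram 1 1 :=
  ⟨[(.cup, 0), (.cross c, 1), (.cap, 0)], ⟨1, rfl, 0, rfl, 1, rfl, rfl⟩⟩

/-- Two strands with two double points, `x` below `y`. -/
def bigon (x y : Crossing) : Diagram 2 2 :=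
  ⟨[(.cross x, 0), (.cross y, 0)], ⟨0, rfl, 0, rfl, rfl⟩⟩

/-- Three strands, numbered from left to right at the bottom; the double point of strands 1, 2
is `x`, that of strands 1, 3 is `y`, that of strands 2, 3 is `z`, and the double point of
strands 1, 3 lies on the right of strand 2. -/
def triangleLeft (x y z : Crossing) : Diagram 3 3 :=
  ⟨[(.cross x, 0), (.cross y, 1), (.cross z, 0)], ⟨1, rfl, 0, rfl, 1, rfl, rfl⟩⟩

/-- The same three strands with the same double points, but now the double point of strands 1, 3
lies on the left of strand 2. -/
def triangleRight (x y z : Crossing) : Diagram 3 3 :=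
  ⟨[(.cross z, 1), (.cross y, 0), (.cross x, 1)], ⟨0, rfl, 1, rfl, 0, rfl, rfl⟩⟩

open Crossing

/-- Type I: a curl at an ordinary crossing is created or removed. -/
def RI : Set LocalMove :=
  {m | ∃ c, c ≠ sing ∧
    (m = move (vertical 1) (curlRight c) ∨ m = move (vertical 1) (curlLeft c))}

/-- Type II: one of two adjacent strands is pushed over the other one. -/
def RII : Set LocalMove :=
  {move (vertical 2) (bigon above below), move (vertical 2) (bigon below above)}

/-- Type III: three ordinary crossings, for all ways to put three strands above each other
(the two excluded choices `(above, below, above)` and `(below, above, below)` are those where no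
strand lies above the two other ones). -/
def RIII : Set LocalMove :=
  {m | ∃ x y z, x ≠ sing ∧ y ≠ sing ∧ z ≠ sing ∧ (y = x ∨ y = z) ∧
    m = move (triangleLeft x y z) (triangleRight x y z)}

/-- Type IV, upper version: a strand (the first, second or third one) passes over a singular
crossing of the two other ones. -/
def RIVO : Set LocalMove :=
  {move (triangleLeft above above sing) (triangleRight above above sing),
   move (triangleLeft below sing above) (triangleRight below sing above),
   move (triangleLeft sing below below) (triangleRight sing below below)}

/-- Type IV, lower version: a strand (the first, second or third one) passes under a singular
crossing of the two other ones. -/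
def RIVU : Set LocalMove :=
  {move (triangleLeft below below sing) (triangleRight below below sing),
   move (triangleLeft above sing below) (triangleRight above sing below),
   move (triangleLeft sing above above) (triangleRight sing above above)}

/-- Type V: a singular crossing and an ordinary crossing which bound a bigon are exchanged. -/
def RV : Set LocalMove :=
  {m | ∃ c, c ≠ sing ∧ m = move (bigon sing c) (bigon c sing)}

/-- All unoriented singular Reidemeister moves, including the ordinary ones. -/
def allMoves : Set LocalMove := RI ∪ RII ∪ RIII ∪ RIVO ∪ RIVU ∪ RV

/-! ### Generating sets -/

/-- `m ≺ S`: the change made by `m` can be achieved by a finite sequence of moves from `S` and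
planar isotopies, without leaving the disk (with fixed boundary) that carries the diagrams.
The changing disk of `m` itself is one of the disks considered here. -/
def GeneratedBy (m : LocalMove) (S : Set LocalMove) : Prop :=
  ∀ (a b : ℕ) (D D' : Diagram a b), m a b D D' →
    Relation.ReflTransGen (fun E E' => PlanarIsotopic E E' ∨ ∃ s ∈ S, s a b E E') D D'

def IsGeneratingSet (S : Set LocalMove) : Prop :=
  S ⊆ allMoves ∧ ∀ m ∈ allMoves, GeneratedBy m S

def IsMinimalGeneratingSet (S : Set LocalMove) : Prop :=
  IsGeneratingSet S ∧ ∀ m ∈ S, ¬ IsGeneratingSet (S \ {m})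

end SingularTangle

open SingularTangle

/-! A local move is a relation between diagrams, so pictures that differ by a rotation of the disk
give equal moves. The rotations are explicit chains of planar isotopies (`triangleMove_rotate`,
`curlLeft_move`, `bigon_move_comm`); they leave at most 2, 1, 2, 1, 1, 2 moves in the six types.

Where a type has two moves, they differ by exchanging `above` and `below`, and either one together
with type II generates the other (`conn_curl`, `conn_triangle`, `conn_flip`). Hence every set of
moves that meets all six types is generating.

Conversely, each type has a rule for coloring arcs whose set of boundary colorings is preserved by
planar isotopy and by all moves of the other five types, but by no move of this type
(`detector_iff`). Hence a generating set meets every type, and the minimal ones pick exactly one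
move from each. Invariance need only be tested on the picture of a move (`respects_move_iff`), which
is a finite computation. Two further colorings show that the two moves of a type are really
different, so that the count is 8. -/

namespace SingularTangle

/-! ### Words as partial functions on the number of strands -/

/-- The number of strands at the top of a word with `a` strands at the bottom. -/
def height : ℕ → Word → Option ℕ
  | a, [] => some a
  | a, (p, i) :: w => if i + p.dom ≤ a then height (a - p.dom + p.cod) w else none

/-- Replaces the existential in `IsDiagram` by a computation, so that concrete words can be checked
by `rfl`. -/
theorem isDiagram_iff {a b : ℕ} {w : Word} : IsDiagram a w b ↔ height a w = some b := by
  induction w generalizing a with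
  | nil => simp [IsDiagram, height]
  | cons x w ih =>
    obtain ⟨p, i⟩ := x
    simp only [IsDiagram, height]
    constructor
    · rintro ⟨r, rfl, h⟩
      rw [if_pos (by omega), ← ih]
      convert h using 1
      omega
    · split_ifs with hi
      · intro h
        refine ⟨a - i - p.dom, by omega, ?_⟩
        rw [ih, ← h]
        congr 1
        omega
      · simp

theorem isDiagram_append {a b : ℕ} {v w : Word} :
    IsDiagram a (v ++ w) b ↔ ∃ c, IsDiagram a v c ∧ IsDiagram c w b := by
  induction v generalizing a with
  | nil => simp [IsDiagram]
  | cons x v ih =>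
    obtain ⟨p, i⟩ := x
    simp only [List.cons_append, IsDiagram, ih]
    constructor
    · rintro ⟨r, h, c, h1, h2⟩
      exact ⟨c, ⟨r, h, h1⟩, h2⟩
    · rintro ⟨c, ⟨r, h, h1⟩, h2⟩
      exact ⟨r, h, c, h1, h2⟩

theorem IsDiagram.unique {a b b' : ℕ} {w : Word} (h : IsDiagram a w b) (h' : IsDiagram a w b') :
    b = b' := by
  rw [isDiagram_iff] at h h'
  exact Option.some_injective _ (h.symm.trans h')

theorem IsDiagram.shift {c d : ℕ} {w : Word} (i r : ℕ) (h : IsDiagram c w d) :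
    IsDiagram (i + c + r) (shift i w) (i + d + r) := by
  induction w generalizing c with
  | nil => simpa [IsDiagram, SingularTangle.shift] using h
  | cons x w ih =>
    obtain ⟨p, j⟩ := x
    obtain ⟨s, rfl, h⟩ := h
    refine ⟨s + r, by simp only; omega, ?_⟩
    have := ih h
    rwa [show i + (j + p.cod + s) + r = i + j + p.cod + (s + r) by omega] at this

@[simp] theorem shift_zero (w : Word) : shift 0 w = w := by
  simp [shift]

theorem shift_append (i : ℕ) (v w : Word) : shift i (v ++ w) = shift i v ++ shift i w := by
  simp [shift]

theorem shift_shift (i j : ℕ) (w : Word) : shift i (shift j w) = shift (i + j) w := by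
  simp [shift, Function.comp_def, add_assoc]

@[simp] theorem Crossing.turn_turn (c : Crossing) : c.turn.turn = c := by
  cases c <;> rfl

/-! ### Colorings -/

/-- A rule to color the arcs of a diagram with `n` colors: `out c x y` lists the pairs of colors
which are allowed at the top of the double point `c` if the colors at its bottom are `x`, `y`.  The
rule does not depend on the direction from which a double point is seen. -/
structure Coloring (n : ℕ) where
  out : Crossing → Fin n → Fin n → List (Fin n × Fin n)
  turn : ∀ c x y z t, (z, t) ∈ out c x y ↔ (x, z) ∈ out c.turn y t

namespace Coloring

variable {n : ℕ} (K : Coloring n)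

/-- The colors above a piece at the left end of its layer, given those below. -/
def piece : Piece → List (Fin n) → List (List (Fin n))
  | .cup, f => (List.finRange n).map fun x => x :: x :: f
  | .cap, x :: y :: f => if x = y then [f] else []
  | .cross c, x :: y :: f => (K.out c x y).map fun z => z.1 :: z.2 :: f
  | _, _ => []

/-- The colors above a layer, given those below. -/
def layer (p : Piece) : ℕ → List (Fin n) → List (List (Fin n))
  | 0, f => K.piece p f
  | _ + 1, [] => []
  | i + 1, x :: f => (layer p i f).map (x :: ·)

/-- The possible colors at the top of a diagram, given those at its bottom. -/
def eval : Word → List (Fin n) → List (List (Fin n))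
  | [], f => [f]
  | (p, i) :: w, f => (K.layer p i f).flatMap (eval w)

theorem mem_eval_append {v w : Word} {f g : List (Fin n)} :
    g ∈ K.eval (v ++ w) f ↔ ∃ h ∈ K.eval v f, g ∈ K.eval w h := by
  induction v generalizing f with
  | nil => simp [eval]
  | cons x v ih =>
    obtain ⟨p, i⟩ := x
    simp only [List.cons_append, eval, List.mem_flatMap, ih]
    constructor
    · rintro ⟨a, ha, h, hh, hg⟩
      exact ⟨h, ⟨a, ha, hh⟩, hg⟩
    · rintro ⟨h, ⟨a, ha, hh⟩, hg⟩
      exact ⟨a, ha, h, hh, hg⟩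

theorem layer_append_left (p : Piece) (i : ℕ) (u f : List (Fin n)) :
    K.layer p (u.length + i) (u ++ f) = (K.layer p i f).map (u ++ ·) := by
  induction u with
  | nil => simp
  | cons x u ih =>
    rw [List.length_cons, show u.length + 1 + i = u.length + i + 1 by omega, List.cons_append,
      layer, ih, List.map_map]
    rfl

theorem piece_append_right (p : Piece) (f v : List (Fin n)) (h : p.dom ≤ f.length) :
    K.piece p (f ++ v) = (K.piece p f).map (· ++ v) := by
  match p, f with
  | .cup, f => simp [piece]
  | .cap, [] => simp [Piece.dom] at h
  | .cap, [x] => simp [Piece.dom] at h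
  | .cap, x :: y :: f => by_cases hxy : x = y <;> simp [piece, hxy]
  | .cross c, [] => simp [Piece.dom] at h
  | .cross c, [x] => simp [Piece.dom] at h
  | .cross c, x :: y :: f => simp [piece]

theorem length_of_mem_piece {p : Piece} {f g : List (Fin n)} (h : g ∈ K.piece p f) :
    g.length + p.dom = f.length + p.cod := by
  match p, f with
  | .cup, f =>
    simp only [piece, List.mem_map] at h
    obtain ⟨x, -, rfl⟩ := h
    simp [Piece.dom, Piece.cod]
  | .cap, [] => simp [piece] at h
  | .cap, [x] => simp [piece] at h
  | .cap, x :: y :: f =>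
    by_cases hxy : x = y
    · simp only [piece, hxy, if_true, List.mem_singleton] at h
      simp [h, Piece.dom, Piece.cod]
    · simp [piece, hxy] at h
  | .cross c, [] => simp [piece] at h
  | .cross c, [x] => simp [piece] at h
  | .cross c, x :: y :: f =>
    simp only [piece, List.mem_map] at h
    obtain ⟨x, -, rfl⟩ := h
    simp [Piece.dom, Piece.cod]

theorem layer_append_right (p : Piece) (i : ℕ) (f v : List (Fin n)) (h : i + p.dom ≤ f.length) :
    K.layer p i (f ++ v) = (K.layer p i f).map (· ++ v) := by
  induction i generalizing f with
  | zero => exact K.piece_append_right p f v (by omega)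
  | succ i ih =>
    cases f with
    | nil => simp at h
    | cons x f =>
      rw [List.cons_append, layer, ih f (by simp at h; omega), layer, List.map_map, List.map_map]
      rfl

theorem length_of_mem_layer {p : Piece} {i : ℕ} {f g : List (Fin n)} (h : g ∈ K.layer p i f) :
    g.length + p.dom = f.length + p.cod := by
  induction i generalizing f g with
  | zero => exact K.length_of_mem_piece h
  | succ i ih =>
    cases f with
    | nil => simp [layer] at h
    | cons x f =>
      simp only [layer, List.mem_map] at h
      obtain ⟨g, hg, rfl⟩ := h
      have := ih hg
      simp only [List.length_cons]
      omega

theorem length_of_mem_eval {a b : ℕ} {w : Word} (hw : IsDiagram a w b) {f g : List (Fin n)}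
    (hf : f.length = a) (h : g ∈ K.eval w f) : g.length = b := by
  induction w generalizing a f with
  | nil =>
    simp only [eval, List.mem_singleton] at h
    exact h ▸ hf.trans hw
  | cons x w ih =>
    obtain ⟨p, i⟩ := x
    obtain ⟨r, rfl, hw⟩ := hw
    simp only [eval, List.mem_flatMap] at h
    obtain ⟨k, hk, hg⟩ := h
    have := K.length_of_mem_layer hk
    exact ih hw (by omega) hg

theorem eval_shift (w : Word) (u f : List (Fin n)) :
    K.eval (shift u.length w) (u ++ f) = (K.eval w f).map (u ++ ·) := by
  induction w generalizing f with
  | nil => simp [eval, shift]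
  | cons x w ih =>
    obtain ⟨p, i⟩ := x
    have : ∀ f, K.eval (List.map (fun x => (x.1, u.length + x.2)) w) (u ++ f) = _ := ih
    simp only [eval, shift, List.map_cons, layer_append_left, List.flatMap_map, this,
      List.map_flatMap]

theorem eval_append_right {a b : ℕ} {w : Word} (hw : IsDiagram a w b) (f v : List (Fin n))
    (hf : f.length = a) : K.eval w (f ++ v) = (K.eval w f).map (· ++ v) := by
  induction w generalizing a f with
  | nil => simp [eval]
  | cons x w ih =>
    obtain ⟨p, i⟩ := x
    obtain ⟨r, rfl, hw⟩ := hw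
    rw [eval, eval, K.layer_append_right p i f v (by omega), List.flatMap_map, List.map_flatMap]
    refine List.flatMap_congr fun g hg => ih hw g ?_
    have := K.length_of_mem_layer hg
    omega

/-! ### Invariance of colorings under planar isotopy and local moves -/

/-- The same colorings are allowed for both words, on `a` strands at the bottom. -/
def Agree (a : ℕ) (v w : Word) : Prop :=
  ∀ f : List (Fin n), f.length = a → ∀ g, g ∈ K.eval v f ↔ g ∈ K.eval w f

variable {K}

theorem Agree.symm {a : ℕ} {v w : Word} (h : K.Agree a v w) : K.Agree a w v :=
  fun f hf g => (h f hf g).symm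

theorem Agree.trans {a : ℕ} {u v w : Word} (h : K.Agree a u v) (h' : K.Agree a v w) :
    K.Agree a u w :=
  fun f hf g => (h f hf g).trans (h' f hf g)

theorem Agree.replaces {a b c d : ℕ} {L R : Diagram c d} (h : K.Agree c L.word R.word)
    {D D' : Diagram a b} (hD : Replaces L R D D') : K.Agree a D.word D'.word := by
  obtain ⟨P, Q, i, r, hP, -, hD, hD'⟩ := hD
  intro f hf g
  -- The colors above `P` split into `i` on the left of the disk, `c` entering it and `r` on its
  -- right; the outer ones pass unchanged.
  have key : ∀ k ∈ K.eval P f, ∀ l,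
      l ∈ K.eval (shift i L.word) k ↔ l ∈ K.eval (shift i R.word) k := by
    intro k hk l
    have hl := K.length_of_mem_eval hP hf hk
    obtain ⟨u, k, rfl, hu⟩ : ∃ u k', k = u ++ k' ∧ u.length = i :=
      ⟨k.take i, k.drop i, by simp, by simp; omega⟩
    obtain ⟨x, v, rfl, hx⟩ : ∃ x v, k = x ++ v ∧ x.length = c :=
      ⟨k.take c, k.drop c, by simp, by simp at hl ⊢; omega⟩
    subst hu
    simp only [eval_shift, K.eval_append_right L.valid x v hx,
      K.eval_append_right R.valid x v hx, List.mem_map, h x hx]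
  rw [hD, hD']
  simp only [mem_eval_append]
  constructor
  · rintro ⟨l, ⟨k, hk, hl⟩, hg⟩
    exact ⟨l, ⟨k, hk, (key k hk l).1 hl⟩, hg⟩
  · rintro ⟨l, ⟨k, hk, hl⟩, hg⟩
    exact ⟨l, ⟨k, hk, (key k hk l).2 hl⟩, hg⟩

theorem agree_exchange (p q : Piece) (k : ℕ) :
    K.Agree (p.dom + k + q.dom) [(p, 0), (q, p.cod + k)] [(q, p.dom + k), (p, 0)] := by
  intro f hf g
  obtain ⟨x, f, rfl, hx⟩ : ∃ x f', f = x ++ f' ∧ x.length = p.dom :=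
    ⟨f.take p.dom, f.drop p.dom, by simp, by simp; omega⟩
  obtain ⟨m, z, rfl, hm⟩ : ∃ m z, f = m ++ z ∧ m.length = k :=
    ⟨f.take k, f.drop k, by simp, by simp at hf ⊢; omega⟩
  have h1 : ∀ w, K.layer p 0 (x ++ w) = (K.piece p x).map (· ++ w) :=
    fun w => K.piece_append_right p x w hx.ge
  have h2 : ∀ l u, u.length = l → K.layer q (l + k) (u ++ (m ++ z)) =
      (K.piece q z).map fun w => u ++ (m ++ w) := by
    rintro l u rfl
    have := K.layer_append_left q 0 (u ++ m) z
    simpa [hm, layer] using this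
  have h3 : ∀ u ∈ K.piece p x, u.length = p.cod := by
    intro u hu
    have := K.length_of_mem_piece hu
    omega
  simp only [eval, List.mem_flatMap, List.mem_singleton, h1, h2 _ _ hx, List.mem_map]
  constructor
  · rintro ⟨_, ⟨u, hu, rfl⟩, hg⟩
    simp only [h2 _ _ (h3 u hu), List.mem_map] at hg
    obtain ⟨_, ⟨w, hw, rfl⟩, rfl⟩ := hg
    refine ⟨_, ⟨w, hw, rfl⟩, _, ?_, rfl⟩
    rw [h1, List.mem_map]
    exact ⟨u, hu, rfl⟩
  · rintro ⟨_, ⟨w, hw, rfl⟩, hg⟩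
    simp only [h1, List.mem_map] at hg
    obtain ⟨_, ⟨u, hu, rfl⟩, rfl⟩ := hg
    refine ⟨_, ⟨u, hu, rfl⟩, _, ?_, rfl⟩
    rw [h2 _ _ (h3 u hu), List.mem_map]
    exact ⟨w, hw, rfl⟩

/-- The two slides are where the rotation invariance `K.turn` of the rule is needed. -/
theorem Agree.planarMove {c d : ℕ} {L R : Diagram c d} (h : PlanarMove L R) :
    K.Agree c L.word R.word := by
  cases h with
  | exchange p q k => exact agree_exchange p q k
  | zigzagLeft =>
    intro f hf g
    obtain ⟨x, rfl⟩ := List.length_eq_one_iff.1 hf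
    simp [eval, layer, piece]
  | zigzagRight =>
    intro f hf g
    obtain ⟨x, rfl⟩ := List.length_eq_one_iff.1 hf
    simp [eval, layer, piece]
    exact eq_comm
  | slideCap c =>
    intro f hf g
    obtain ⟨x, y, z, rfl⟩ := List.length_eq_three.1 hf
    simp [eval, layer, piece]
    simp only [K.turn c, eq_comm]
  | slideCup c =>
    intro f hf g
    obtain ⟨x, rfl⟩ := List.length_eq_one_iff.1 hf
    simp [eval, layer, piece]
    constructor
    · rintro ⟨s, p, q, h, rfl⟩
      refine ⟨p, q, s, ?_, rfl⟩
      rwa [K.turn, Crossing.turn_turn]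
    · rintro ⟨p, q, s, h, rfl⟩
      refine ⟨s, p, q, ?_, rfl⟩
      rwa [K.turn, Crossing.turn_turn] at h

theorem Agree.planarIsotopic {a b : ℕ} {D D' : Diagram a b} (h : PlanarIsotopic D D') :
    K.Agree a D.word D'.word := by
  induction h with
  | rel _ _ h =>
    obtain ⟨c, d, L, R, hm, hr⟩ := h
    exact (Agree.planarMove hm).replaces hr
  | refl => exact fun _ _ _ => Iff.rfl
  | symm _ _ _ ih => exact ih.symm
  | trans _ _ _ _ _ ih ih' => exact ih.trans ih'

variable (K)

/-- A local move which does not change the set of colorings. -/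
def Respects (m : LocalMove) : Prop :=
  ∀ a b (D D' : Diagram a b), m a b D D' → K.Agree a D.word D'.word

/-- Colorings are local and isotopy invariant, so the surroundings of the changing disk do not
matter; conversely, the picture is itself a diagram. -/
theorem respects_move_iff {c d : ℕ} {L R : Diagram c d} :
    K.Respects (move L R) ↔ K.Agree c L.word R.word := by
  constructor
  · intro h
    refine h c d L R ⟨L, R, .refl _, .inl ⟨[], [], 0, 0, ?_, ?_, ?_, ?_⟩, .refl _⟩ <;>
      simp [IsDiagram]
  · rintro h a b D D' ⟨E, E', h1, h2 | h2, h3⟩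
    · exact (Agree.planarIsotopic h1).trans ((h.replaces h2).trans (Agree.planarIsotopic h3))
    · exact (Agree.planarIsotopic h1).trans ((h.symm.replaces h2).trans (Agree.planarIsotopic h3))

variable {K}

theorem Respects.of_generatedBy {m : LocalMove} {S : Set LocalMove} (hS : ∀ s ∈ S, K.Respects s)
    (h : GeneratedBy m S) : K.Respects m := by
  intro a b D D' hD
  have h := h a b D D' hD
  clear hD
  induction h with
  | refl => exact fun _ _ _ => Iff.rfl
  | tail _ h ih =>
    rcases h with h | ⟨s, hs, h⟩
    · exact ih.trans (Agree.planarIsotopic h)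
    · exact ih.trans (hS s hs _ _ _ _ h)

end Coloring

/-! ### Diagrams inside of other diagrams -/

/-- The diagram obtained from `L` by adding `i` strands on its left, `r` strands on its right,
`P` below and `Q` above. -/
def plug {a b c d : ℕ} (P Q : Word) (i r : ℕ) (hP : IsDiagram a P (i + c + r))
    (hQ : IsDiagram (i + d + r) Q b) (L : Diagram c d) : Diagram a b :=
  ⟨P ++ shift i L.word ++ Q, isDiagram_append.2
    ⟨_, isDiagram_append.2 ⟨_, hP, L.valid.shift i r⟩, hQ⟩⟩

theorem Diagram.ext_word {a b : ℕ} {D D' : Diagram a b} (h : D.word = D'.word) : D = D' := by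
  cases D
  cases D'
  simpa using h

theorem replaces_iff {a b c d : ℕ} {L R : Diagram c d} {D D' : Diagram a b} :
    Replaces L R D D' ↔ ∃ P Q i r hP hQ, D = plug P Q i r hP hQ L ∧ D' = plug P Q i r hP hQ R := by
  constructor
  · rintro ⟨P, Q, i, r, hP, hQ, hD, hD'⟩
    exact ⟨P, Q, i, r, hP, hQ, Diagram.ext_word hD, Diagram.ext_word hD'⟩
  · rintro ⟨P, Q, i, r, hP, hQ, rfl, rfl⟩
    exact ⟨P, Q, i, r, hP, hQ, rfl, rfl⟩

theorem Replaces.plug {a b c d e f : ℕ} {A B : Diagram e f} {L R : Diagram c d}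
    (h : Replaces A B L R) (P Q : Word) (i r : ℕ) (hP : IsDiagram a P (i + c + r))
    (hQ : IsDiagram (i + d + r) Q b) :
    Replaces A B (plug P Q i r hP hQ L) (plug P Q i r hP hQ R) := by
  obtain ⟨P', Q', i', r', hP', hQ', hL, hR⟩ := h
  refine ⟨P ++ shift i P', shift i Q' ++ Q, i + i', r' + r, ?_, ?_, ?_, ?_⟩
  · refine isDiagram_append.2 ⟨_, hP, ?_⟩
    convert hP'.shift i r using 1
    omega
  · refine isDiagram_append.2 ⟨_, ?_, hQ⟩
    convert hQ'.shift i r using 1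
    omega
  · simp [SingularTangle.plug, hL, shift_append, shift_shift]
  · simp [SingularTangle.plug, hR, shift_append, shift_shift]

theorem PlanarIsotopic.plug {a b c d : ℕ} {L R : Diagram c d} (h : PlanarIsotopic L R)
    (P Q : Word) (i r : ℕ) (hP : IsDiagram a P (i + c + r)) (hQ : IsDiagram (i + d + r) Q b) :
    PlanarIsotopic (plug P Q i r hP hQ L) (plug P Q i r hP hQ R) := by
  induction h with
  | rel _ _ h =>
    obtain ⟨e, f, A, B, hm, hr⟩ := h
    exact .rel _ _ ⟨e, f, A, B, hm, hr.plug P Q i r hP hQ⟩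
  | refl => exact .refl _
  | symm _ _ _ ih => exact ih.symm
  | trans _ _ _ _ _ ih ih' => exact ih.trans _ _ _ ih'

theorem move_plug {a b c d e f : ℕ} {A B : Diagram e f} {L R : Diagram c d}
    (h : move A B c d L R) (P Q : Word) (i r : ℕ) (hP : IsDiagram a P (i + c + r))
    (hQ : IsDiagram (i + d + r) Q b) :
    move A B a b (plug P Q i r hP hQ L) (plug P Q i r hP hQ R) := by
  obtain ⟨E, E', h1, h2, h3⟩ := h
  exact ⟨_, _, h1.plug P Q i r hP hQ, h2.imp (·.plug P Q i r hP hQ) (·.plug P Q i r hP hQ),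
    h3.plug P Q i r hP hQ⟩

theorem move_symm {a b c d : ℕ} {L R : Diagram c d} {D D' : Diagram a b}
    (h : move L R a b D D') : move L R a b D' D := by
  obtain ⟨E, E', h1, h2, h3⟩ := h
  refine ⟨E', E, h3.symm, ?_, h1.symm⟩
  rcases h2 with ⟨P, Q, i, r, hP, hQ, h, h'⟩ | ⟨P, Q, i, r, hP, hQ, h, h'⟩
  · exact .inr ⟨P, Q, i, r, hP, hQ, h', h⟩
  · exact .inl ⟨P, Q, i, r, hP, hQ, h', h⟩

theorem move_comm {c d : ℕ} (L R : Diagram c d) : move L R = move R L := by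
  funext a b D D'
  simp only [move, or_comm]

theorem move_self {c d : ℕ} (L R : Diagram c d) : move L R c d L R :=
  ⟨L, R, .refl _, .inl ⟨[], [], 0, 0, by simp [IsDiagram], by simp [IsDiagram], by simp,
    by simp⟩, .refl _⟩

/-- If the two sides of a picture contain the two sides of another picture in the same place, then
the first local move is a special case of the second one. -/
theorem move_le_move {c d e f : ℕ} {L R L₀ R₀ : Diagram c d} {A B : Diagram e f}
    (hL : PlanarIsotopic L L₀) (hR : PlanarIsotopic R R₀) (h : Replaces A B L₀ R₀) :
    move L R ≤ move A B := by
  rintro a b D D' ⟨E, E', h1, h2, h3⟩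
  rcases h2 with h2 | h2 <;> obtain ⟨P, Q, i, r, hP, hQ, rfl, rfl⟩ := replaces_iff.1 h2
  · exact ⟨_, _, h1.trans _ _ _ (hL.plug P Q i r hP hQ), .inl (h.plug P Q i r hP hQ),
      (hR.plug P Q i r hP hQ).symm.trans _ _ _ h3⟩
  · rw [move_comm]
    refine ⟨_, _, h1.trans _ _ _ (hR.plug P Q i r hP hQ), .inl ?_,
      (hL.plug P Q i r hP hQ).symm.trans _ _ _ h3⟩
    obtain ⟨P', Q', i', r', hP', hQ', hL, hR⟩ := h
    exact Replaces.plug ⟨P', Q', i', r', hP', hQ', hR, hL⟩ P Q i r hP hQ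

/-! ### Planar isotopies of words -/

/-- Planar isotopy of words, as diagrams with `a` endpoints at the bottom and `b` at the top. -/
def Iso (a b : ℕ) (v w : Word) : Prop :=
  ∃ (hv : IsDiagram a v b) (hw : IsDiagram a w b), PlanarIsotopic ⟨v, hv⟩ ⟨w, hw⟩

theorem Iso.symm {a b : ℕ} {v w : Word} (h : Iso a b v w) : Iso a b w v :=
  let ⟨hv, hw, h⟩ := h
  ⟨hw, hv, .symm _ _ h⟩

theorem Iso.trans {a b : ℕ} {u v w : Word} (h : Iso a b u v) (h' : Iso a b v w) : Iso a b u w :=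
  let ⟨hu, _, h⟩ := h
  let ⟨_, hw, h'⟩ := h'
  ⟨hu, hw, .trans _ _ _ h h'⟩

theorem Iso.refl {a b : ℕ} (w : Word) (h : height a w = some b) : Iso a b w w :=
  ⟨isDiagram_iff.2 h, isDiagram_iff.2 h, .refl _⟩

/-- A word which contains the word of a given diagram. -/
theorem eq_plug {a b c d n : ℕ} {P Q : Word} {i : ℕ} {L : Diagram c d}
    (hP : height a P = some n) (hn : i + c ≤ n)
    (hw : IsDiagram a (P ++ shift i L.word ++ Q) b) :
    ∃ (r : ℕ) (hP : IsDiagram a P (i + c + r)) (hQ : IsDiagram (i + d + r) Q b),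
      (⟨P ++ shift i L.word ++ Q, hw⟩ : Diagram a b) = plug P Q i r hP hQ L := by
  obtain ⟨r, rfl⟩ := Nat.exists_eq_add_of_le hn
  have hP' := isDiagram_iff.2 hP
  obtain ⟨m, hm, hQ⟩ := isDiagram_append.1 hw
  obtain ⟨l, hl, hm⟩ := isDiagram_append.1 hm
  obtain rfl := hP'.unique hl
  obtain rfl := hm.unique (L.valid.shift i r)
  exact ⟨r, hP', hQ, rfl⟩

/-- Prepends one planar move to a chain of isotopies. The side conditions are closed computations on
concrete words, so that a chain only has to name the prefix `P` and the position. -/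
theorem Iso.cons_planarMove {a b c d n : ℕ} {L R : Diagram c d}
    (h : PlanarMove L R ∨ PlanarMove R L) {P Q u w : Word} {i : ℕ}
    (hu : u = P ++ shift i L.word ++ Q) (hP : height a P = some n) (hn : Nat.ble (i + c) n = true)
    (h' : Iso a b (P ++ shift i R.word ++ Q) w) : Iso a b u w := by
  obtain ⟨hR, hw, h'⟩ := h'
  obtain ⟨r, hP, hQ, he⟩ := eq_plug hP (Nat.le_of_ble_eq_true hn) hR
  subst hu
  refine ⟨(plug P Q i r hP hQ L).valid, hw, .trans _ _ _ ?_ (he ▸ h')⟩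
  rcases h with h | h
  · exact .rel _ _ ⟨c, d, L, R, h, replaces_iff.2 ⟨P, Q, i, r, hP, hQ, rfl, rfl⟩⟩
  · exact .symm _ _ (.rel _ _ ⟨c, d, R, L, h, replaces_iff.2 ⟨P, Q, i, r, hP, hQ, rfl, rfl⟩⟩)

namespace Iso

variable {a b n : ℕ} {Q u w : Word}

/-- The piece `p` at position `i` is moved above the piece `q` which is on its right. -/
theorem up (P : Word) (p q : Piece) (i k : ℕ)
    (h : Iso a b (P ++ (q, i + (p.dom + k)) :: (p, i) :: Q) w)
    (hu : u = P ++ (p, i) :: (q, i + (p.cod + k)) :: Q := by rfl)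
    (hP : height a P = some n := by rfl)
    (hn : Nat.ble (i + (p.dom + k + q.dom)) n = true := by rfl) : Iso a b u w :=
  cons_planarMove (Q := Q) (.inl (.exchange p q k)) (by simp [shift, hu]) hP hn (by simpa [shift] using h)

/-- The piece `p` at position `i` is moved below the piece `q` which is on its right. -/
theorem down (P : Word) (p q : Piece) (i k : ℕ)
    (h : Iso a b (P ++ (p, i) :: (q, i + (p.cod + k)) :: Q) w)
    (hu : u = P ++ (q, i + (p.dom + k)) :: (p, i) :: Q := by rfl)
    (hP : height a P = some n := by rfl)
    (hn : Nat.ble (i + (p.dom + k + q.dom)) n = true := by rfl) : Iso a b u w :=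
  cons_planarMove (Q := Q) (.inr (.exchange p q k)) (by simp [shift, hu]) hP hn (by simpa [shift] using h)

theorem zigzagLeft (P : Word) (i : ℕ) (h : Iso a b (P ++ Q) w)
    (hu : u = P ++ (.cup, i + 1) :: (.cap, i) :: Q := by rfl)
    (hP : height a P = some n := by rfl) (hn : Nat.ble (i + 1) n = true := by rfl) : Iso a b u w :=
  cons_planarMove (Q := Q) (.inl .zigzagLeft) (by simp [shift, hu]) hP hn (by simpa [shift] using h)

theorem zigzagRight (P : Word) (i : ℕ) (h : Iso a b (P ++ Q) w)
    (hu : u = P ++ (.cup, i) :: (.cap, i + 1) :: Q := by rfl)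
    (hP : height a P = some n := by rfl) (hn : Nat.ble (i + 1) n = true := by rfl) : Iso a b u w :=
  cons_planarMove (Q := Q) (.inl .zigzagRight) (by simp [shift, hu]) hP hn (by simpa [shift] using h)

theorem slideCap (P : Word) (c : Crossing) (i : ℕ)
    (h : Iso a b (P ++ (.cross c.turn, i + 1) :: (.cap, i) :: Q) w)
    (hu : u = P ++ (.cross c, i) :: (.cap, i + 1) :: Q := by rfl)
    (hP : height a P = some n := by rfl) (hn : Nat.ble (i + 3) n = true := by rfl) : Iso a b u w :=
  cons_planarMove (Q := Q) (.inl (.slideCap c)) (by simp [shift, hu]) hP hn (by simpa [shift] using h)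

theorem slideCap_symm (P : Word) (c : Crossing) (i : ℕ)
    (h : Iso a b (P ++ (.cross c.turn, i) :: (.cap, i + 1) :: Q) w)
    (hu : u = P ++ (.cross c, i + 1) :: (.cap, i) :: Q := by rfl)
    (hP : height a P = some n := by rfl) (hn : Nat.ble (i + 3) n = true := by rfl) : Iso a b u w :=
  cons_planarMove (Q := Q) (.inr (.slideCap c.turn)) (by simp [shift, hu]) hP hn (by simpa [shift] using h)

theorem slideCup (P : Word) (c : Crossing) (i : ℕ)
    (h : Iso a b (P ++ (.cup, i) :: (.cross c.turn, i + 1) :: Q) w)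
    (hu : u = P ++ (.cup, i + 1) :: (.cross c, i) :: Q := by rfl)
    (hP : height a P = some n := by rfl) (hn : Nat.ble (i + 1) n = true := by rfl) : Iso a b u w :=
  cons_planarMove (Q := Q) (.inl (.slideCup c)) (by simp [shift, hu]) hP hn (by simpa [shift] using h)

theorem slideCup_symm (P : Word) (c : Crossing) (i : ℕ)
    (h : Iso a b (P ++ (.cup, i + 1) :: (.cross c.turn, i) :: Q) w)
    (hu : u = P ++ (.cup, i) :: (.cross c, i + 1) :: Q := by rfl)
    (hP : height a P = some n := by rfl) (hn : Nat.ble (i + 1) n = true := by rfl) : Iso a b u w :=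
  cons_planarMove (Q := Q) (.inr (.slideCup c.turn)) (by simp [shift, hu]) hP hn (by simpa [shift] using h)

end Iso

/-! ### Rotations of pictures -/

open SingularTangle.Piece (cup cap cross)

/-- The cup on the right and the cap on the left shift the six endpoints of the disk by one. This
sixth of a turn exchanges the two sides of the triangle and permutes the three double points,
turning two of them. -/
theorem iso_triangleLeft_rotate (x y z : Crossing) : Iso 3 3
    [(cup, 3), (cross x, 1), (cross y, 2), (cross z, 1), (cap, 0)]
    (triangleRight y.turn z.turn x).word :=
  .slideCap_symm [(cup, 3), (cross x, 1), (cross y, 2)] z 0 <|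
  .down [(cup, 3), (cross x, 1)] (cross z.turn) (cross y) 0 0 <|
  .slideCap_symm [(cup, 3), (cross x, 1), (cross z.turn, 0)] y 1 <|
  .down [] (cross x) cup 1 0 <|
  .down [(cross x, 1)] (cross z.turn) cup 0 1 <|
  .down [(cross x, 1), (cross z.turn, 0)] (cross y.turn) cup 1 0 <|
  .zigzagLeft [(cross x, 1), (cross z.turn, 0), (cross y.turn, 1)] 2 <|
  .refl _ rfl

theorem iso_triangleRight_rotate (x y z : Crossing) : Iso 3 3
    [(cup, 3), (cross z, 2), (cross y, 1), (cross x, 2), (cap, 0)]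
    (triangleLeft y.turn z.turn x).word :=
  .slideCup [] z 2 <|
  .down [(cup, 2), (cross z.turn, 3), (cross y, 1)] cap (cross x) 0 0 <|
  .slideCap_symm [(cup, 2), (cross z.turn, 3)] y 0 <|
  .down [(cup, 2)] (cross y.turn) (cross z.turn) 0 1 <|
  .down [(cup, 2), (cross y.turn, 0)] cap (cross z.turn) 1 0 <|
  .down [] (cross y.turn) cup 0 0 <|
  .zigzagLeft [(cross y.turn, 0)] 1 <|
  .refl _ rfl

/-- With two endpoints, a shift by one is a half turn. The crossing is turned twice and so stays the
same, but the curl changes sides. -/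
theorem iso_curlLeft_rotate (c : Crossing) : Iso 1 1
    [(cup, 1), (cup, 1), (cross c, 2), (cap, 1), (cap, 0)] (curlRight c).word := by
  have h : Iso 1 1 _ (curlRight c.turn.turn).word :=
    .down [] cup cup 1 0 <|
    .slideCup [(cup, 1)] c 2 <|
    .down [(cup, 1), (cup, 2)] cap (cross c.turn) 1 0 <|
    .zigzagLeft [(cup, 1)] 1 <|
    .slideCap_symm [(cup, 1)] c.turn 0 <|
    .refl _ rfl
  rwa [Crossing.turn_turn] at h

theorem iso_curlRight_rotate (c : Crossing) : Iso 1 1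
    [(cup, 0), (cup, 2), (cross c, 1), (cap, 2), (cap, 1)] (curlLeft c).word := by
  have h : Iso 1 1 _ (curlLeft c.turn.turn).word :=
    .up [] cup cup 0 0 <|
    .slideCup_symm [(cup, 0)] c 0 <|
    .up [(cup, 0), (cup, 1)] (cross c.turn) cap 0 0 <|
    .zigzagRight [(cup, 0)] 1 <|
    .slideCap [(cup, 0)] c.turn 0 <|
    .refl _ rfl
  rwa [Crossing.turn_turn] at h

theorem iso_vertical_rotate : Iso 2 2 [(cup, 2), (cup, 3), (cap, 1), (cap, 0)] (vertical 2).word :=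
  .down [(cup, 2)] cap cup 1 0 <|
  .zigzagLeft [] 1 <|
  .zigzagLeft [] 0 <|
  .refl _ rfl

theorem iso_bigon_rotate (x y : Crossing) : Iso 2 2
    [(cup, 2), (cup, 3), (cross x, 2), (cross y, 2), (cap, 1), (cap, 0)] (bigon y x).word := by
  have h : Iso 2 2 _ (bigon y.turn.turn x.turn.turn).word :=
    .slideCap_symm [(cup, 2), (cup, 3), (cross x, 2)] y 1 <|
    .down [(cup, 2), (cup, 3), (cross x, 2), (cross y.turn, 1)] cap cap 0 0 <|
    .slideCap_symm [(cup, 2), (cup, 3), (cross x, 2)] y.turn 0 <|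
    .down [(cup, 2), (cup, 3)] (cross y.turn.turn) (cross x) 0 0 <|
    .down [(cup, 2)] (cross y.turn.turn) cup 0 1 <|
    .down [] (cross y.turn.turn) cup 0 0 <|
    .slideCap_symm [(cross y.turn.turn, 0), (cup, 2), (cup, 3)] x 1 <|
    .down [(cross y.turn.turn, 0), (cup, 2), (cup, 3), (cross x.turn, 1)] cap cap 0 0 <|
    .slideCap_symm [(cross y.turn.turn, 0), (cup, 2), (cup, 3)] x.turn 0 <|
    .down [(cross y.turn.turn, 0), (cup, 2)] (cross x.turn.turn) cup 0 1 <|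
    .down [(cross y.turn.turn, 0)] (cross x.turn.turn) cup 0 0 <|
    .down [(cross y.turn.turn, 0), (cross x.turn.turn, 0), (cup, 2)] cap cup 1 0 <|
    .zigzagLeft [(cross y.turn.turn, 0), (cross x.turn.turn, 0)] 1 <|
    .zigzagLeft [(cross y.turn.turn, 0), (cross x.turn.turn, 0)] 0 <|
    .refl _ rfl
  rwa [Crossing.turn_turn, Crossing.turn_turn] at h

theorem move_le_of_iso {c d e f : ℕ} {L R : Diagram c d} {A B : Diagram e f} (P Q : Word)
    (i r : ℕ) (hP : height c P = some (i + e + r)) (hQ : height (i + f + r) Q = some d)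
    (hL : Iso c d (P ++ shift i A.word ++ Q) L.word)
    (hR : Iso c d (P ++ shift i B.word ++ Q) R.word) : move L R ≤ move A B :=
  move_le_move hL.symm.2.2 hR.symm.2.2
    ⟨P, Q, i, r, isDiagram_iff.2 hP, isDiagram_iff.2 hQ, rfl, rfl⟩

/-- The move which pushes a strand across the double point of two other ones. -/
abbrev triangleMove (x y z : Crossing) : LocalMove :=
  move (triangleLeft x y z) (triangleRight x y z)

theorem triangleMove_rotate_le (x y z : Crossing) :
    triangleMove y.turn z.turn x ≤ triangleMove x y z := by
  rw [triangleMove, move_comm]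
  exact move_le_of_iso [(cup, 3)] [(cap, 0)] 1 1 rfl rfl (iso_triangleLeft_rotate x y z)
    (iso_triangleRight_rotate x y z)

theorem triangleMove_rotate (x y z : Crossing) :
    triangleMove y.turn z.turn x = triangleMove x y z := by
  refine le_antisymm (triangleMove_rotate_le x y z) ?_
  have h1 := triangleMove_rotate_le y.turn z.turn x
  -- Three rotations restore the labels, so two more of them give the reverse inclusion.
  have h2 := triangleMove_rotate_le z.turn.turn x.turn y.turn
  simp only [Crossing.turn_turn] at h1 h2
  exact h2.trans h1

theorem curlLeft_move (c : Crossing) :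
    move (vertical 1) (curlLeft c) = move (vertical 1) (curlRight c) :=
  le_antisymm
    (move_le_of_iso [(cup, 0)] [(cap, 1)] 1 1 rfl rfl (.zigzagRight [] 0 (.refl _ rfl))
      (iso_curlRight_rotate c))
    (move_le_of_iso [(cup, 1)] [(cap, 0)] 1 1 rfl rfl (.zigzagLeft [] 0 (.refl _ rfl))
      (iso_curlLeft_rotate c))

/-- A half turn of the disk, here a shift of four endpoints by two, reverses the vertical order of
the crossings. -/
theorem bigon_move_comm (x y : Crossing) :
    move (vertical 2) (bigon x y) = move (vertical 2) (bigon y x) :=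
  have h : ∀ x y, move (vertical 2) (bigon y x) ≤ move (vertical 2) (bigon x y) := fun x y =>
    move_le_of_iso [(cup, 2), (cup, 3)] [(cap, 1), (cap, 0)] 2 2 rfl rfl iso_vertical_rotate
      (iso_bigon_rotate x y)
  le_antisymm (h y x) (h x y)

/-! ### Sequences of moves -/

/-- The word `v` can be changed into `w` by planar isotopies and moves in `S`. -/
def Conn (S : Set LocalMove) (a b : ℕ) (v w : Word) : Prop :=
  ∃ (hv : IsDiagram a v b) (hw : IsDiagram a w b),
    Relation.ReflTransGen (fun E E' => PlanarIsotopic E E' ∨ ∃ s ∈ S, s a b E E')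
      (⟨v, hv⟩ : Diagram a b) ⟨w, hw⟩

namespace Conn

variable {S : Set LocalMove} {a b : ℕ} {u v w : Word}

theorem of_iso (h : Iso a b v w) : Conn S a b v w :=
  let ⟨hv, hw, h⟩ := h
  ⟨hv, hw, .single (.inl h)⟩

theorem trans (h : Conn S a b u v) (h' : Conn S a b v w) : Conn S a b u w :=
  let ⟨hu, _, h⟩ := h
  let ⟨_, hw, h'⟩ := h'
  ⟨hu, hw, h.trans h'⟩

theorem refl (w : Word) (h : height a w = some b) : Conn S a b w w :=
  .of_iso (.refl w h)

theorem cons_move {c d n : ℕ} {L R : Diagram c d} (P : Word) (i : ℕ) {Q : Word}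
    (h : Conn S a b (P ++ shift i R.word ++ Q) w) (hS : move L R ∈ S)
    (hu : u = P ++ shift i L.word ++ Q := by rfl) (hP : height a P = some n := by rfl)
    (hn : Nat.ble (i + c) n = true := by rfl) : Conn S a b u w := by
  obtain ⟨hR, hw, h⟩ := h
  obtain ⟨r, hP, hQ, he⟩ := eq_plug hP (Nat.le_of_ble_eq_true hn) hR
  subst hu
  refine ⟨(plug P Q i r hP hQ L).valid, hw, .head (.inr ⟨_, hS, ?_⟩) h⟩
  rw [he]
  exact move_plug (move_self L R) P Q i r hP hQ

/-- Arbitrary relations need be neither local nor symmetric; the form `move A B` of the elements of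
`S` lets a sequence of moves be carried into a larger diagram and be reversed. -/
theorem generatedBy {c d : ℕ} {L R : Diagram c d}
    (hS : ∀ s ∈ S, ∃ (e f : ℕ) (A B : Diagram e f), s = move A B)
    (h : Conn S c d L.word R.word) : GeneratedBy (move L R) S := by
  intro a b D D' ⟨E, E', h1, h2, h3⟩
  obtain ⟨_, _, h⟩ := h
  have key : ∀ X Y : Diagram c d, Relation.ReflTransGen
      (fun E E' => PlanarIsotopic E E' ∨ ∃ s ∈ S, s c d E E') X Y →
      ∀ P Q i r hP hQ, Relation.ReflTransGen
      (fun E E' => PlanarIsotopic E E' ∨ ∃ s ∈ S, s a b E E')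
      (plug P Q i r hP hQ X) (plug P Q i r hP hQ Y) := by
    intro X Y h P Q i r hP hQ
    induction h with
    | refl => exact .refl
    | tail _ h ih =>
      refine ih.tail ?_
      rcases h with h | ⟨s, hs, h⟩
      · exact .inl (h.plug P Q i r hP hQ)
      · obtain ⟨e, f, A, B, rfl⟩ := hS s hs
        exact .inr ⟨_, hs, move_plug h P Q i r hP hQ⟩
  have symm : ∀ {D D' : Diagram a b}, Relation.ReflTransGen
      (fun E E' => PlanarIsotopic E E' ∨ ∃ s ∈ S, s a b E E') D D' → Relation.ReflTransGen
      (fun E E' => PlanarIsotopic E E' ∨ ∃ s ∈ S, s a b E E') D' D := by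
    intro D D' h
    induction h with
    | refl => exact .refl
    | tail _ h ih =>
      refine .head ?_ ih
      rcases h with h | ⟨s, hs, h⟩
      · exact .inl h.symm
      · obtain ⟨e, f, A, B, rfl⟩ := hS s hs
        exact .inr ⟨_, hs, move_symm h⟩
  refine .head (.inl h1) (.tail ?_ (.inl h3))
  rcases h2 with h2 | h2 <;> obtain ⟨P, Q, i, r, hP, hQ, rfl, rfl⟩ := replaces_iff.1 h2
  · exact key L R h P Q i r hP hQ
  · exact symm (key L R h P Q i r hP hQ)

end Conn

open Crossing

/-! ### One move of each type suffices -/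

/-- The creation of a curl. -/
abbrev curlMove (c : Crossing) : LocalMove := move (vertical 1) (curlRight c)

/-- The creation of a bigon. -/
abbrev bigonMove : LocalMove := move (vertical 2) (bigon above below)

/-- The exchange of a singular and an ordinary crossing. -/
abbrev flipMove (c : Crossing) : LocalMove := move (bigon sing c) (bigon c sing)

variable {S : Set LocalMove}

theorem bigon_move_mem (h : bigonMove ∈ S) {x : Crossing} (hx : x ≠ sing) :
    move (vertical 2) (bigon x x.turn) ∈ S := by
  cases x
  · exact h
  · change move (vertical 2) (bigon below above) ∈ S
    rwa [bigon_move_comm]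
  · exact absurd rfl hx

namespace Conn

variable {a b n : ℕ} {u w Q : Word}

theorem insert (hS : bigonMove ∈ S) (P : Word) (i : ℕ) (x : Crossing) (hx : x ≠ sing)
    (h : Conn S a b (P ++ (cross x, i) :: (cross x.turn, i) :: Q) w)
    (hu : u = P ++ Q := by rfl) (hP : height a P = some n := by rfl)
    (hn : Nat.ble (i + 2) n = true := by rfl) : Conn S a b u w :=
  cons_move (Q := Q) P i (by simpa [shift, bigon] using h) (bigon_move_mem hS hx)
    (by simp [hu, shift, vertical]) hP hn

theorem cancel (hS : bigonMove ∈ S) (P : Word) (i : ℕ) (x : Crossing) (hx : x ≠ sing)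
    (h : Conn S a b (P ++ Q) w)
    (hu : u = P ++ (cross x, i) :: (cross x.turn, i) :: Q := by rfl)
    (hP : height a P = some n := by rfl)
    (hn : Nat.ble (i + 2) n = true := by rfl) : Conn S a b u w :=
  cons_move (Q := Q) P i (by simpa [shift, vertical] using h)
    (move_comm _ _ ▸ bigon_move_mem hS hx)
    (by simp [hu, shift, bigon]) hP hn

end Conn

theorem turn_ne_sing {c : Crossing} (hc : c ≠ sing) : c.turn ≠ sing := by
  cases c <;> simp_all [turn]

/-- Bend the strand into an S and push two adjacent parts of it across each other. One of the two
new crossings bounds a curl that `curlMove c` removes; the other one remains as the wanted curl. -/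
theorem conn_curl {c : Crossing} (hc : c ≠ sing) (hII : bigonMove ∈ S) (hI : curlMove c ∈ S) :
    Conn S 1 1 (vertical 1).word (curlLeft c.turn).word := by
  have h : Conn S 1 1 [(cup, 0), (cup, 0), (cross c, 1), (cap, 0), (cross c, 0), (cap, 1)]
      (curlLeft c.turn).word :=
    .cons_move (L := curlLeft c) (R := vertical 1) [(cup, 0)] 0
      (.of_iso (.slideCap [(cup, 0)] c 0 (.refl _ rfl)))
      (by rwa [move_comm, curlLeft_move])
  have h' : Iso 1 1 [(cup, 0), (cup, 0), (cross c, 1), (cap, 0), (cross c, 0), (cap, 1)]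
      [(cup, 0), (cross c.turn, 0), (cross c, 0), (cap, 1)] :=
    .slideCap_symm [(cup, 0), (cup, 0)] c 0 <|
    .down [] cup cup 0 0 <|
    .down [(cup, 0)] (cross c.turn) cup 0 0 <|
    .zigzagLeft [(cup, 0), (cross c.turn, 0)] 1 <|
    .refl _ rfl
  refine .trans (.of_iso (.symm (.zigzagRight [] 0 (.refl _ rfl)))) <|
    .insert hII [(cup, 0)] 0 c.turn (turn_ne_sing hc) ?_
  rw [turn_turn]
  exact .trans (.of_iso h'.symm) h

/-- The braid relation for inverse generators: three bigons insert the inverse of the target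
followed by the target, the known move turns that inverse into the inverse of the source, and
everything else cancels. -/
theorem conn_triangle {c : Crossing} (hc : c ≠ sing) (hII : bigonMove ∈ S)
    (hIII : triangleMove c c c ∈ S) :
    Conn S 3 3 (triangleLeft c.turn c.turn c.turn).word
      (triangleRight c.turn c.turn c.turn).word := by
  have h : Conn S 3 3 [(cross c.turn, 0), (cross c.turn, 1), (cross c.turn, 0),
      (cross c.turn.turn, 0), (cross c.turn.turn, 1), (cross c.turn.turn, 0),
      (cross c.turn, 1), (cross c.turn, 0), (cross c.turn, 1)]
      (triangleRight c.turn c.turn c.turn).word :=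
    .cancel hII [(cross c.turn, 0), (cross c.turn, 1)] 0 c.turn (turn_ne_sing hc) <|
    .cancel hII [(cross c.turn, 0)] 1 c.turn (turn_ne_sing hc) <|
    .cancel hII [] 0 c.turn (turn_ne_sing hc) <|
    .refl _ rfl
  rw [turn_turn] at h
  exact .insert hII [(cross c.turn, 0), (cross c.turn, 1), (cross c.turn, 0)] 1 c hc <|
    .insert hII [(cross c.turn, 0), (cross c.turn, 1), (cross c.turn, 0), (cross c, 1)] 0 c hc <|
    .insert hII [(cross c.turn, 0), (cross c.turn, 1), (cross c.turn, 0), (cross c, 1),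
      (cross c, 0)] 1 c hc <|
    .cons_move (L := triangleRight c c c) (R := triangleLeft c c c)
      [(cross c.turn, 0), (cross c.turn, 1), (cross c.turn, 0)] 0 h (by rwa [move_comm])

/-- Conjugation: if `τ` commutes with `σ`, it commutes with the inverse of `σ`. -/
theorem conn_flip {c : Crossing} (hc : c ≠ sing) (hII : bigonMove ∈ S)
    (hV : flipMove c ∈ S) : Conn S 2 2 (bigon sing c.turn).word (bigon c.turn sing).word := by
  have h : Conn S 2 2 [(cross c.turn, 0), (cross sing, 0), (cross c, 0), (cross c.turn, 0)]
      [(cross c.turn, 0), (cross sing, 0)] :=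
    .cancel hII [(cross c.turn, 0), (cross sing, 0)] 0 c hc (.refl _ rfl)
  have h' : Conn S 2 2 [(cross c.turn, 0), (cross c.turn.turn, 0), (cross sing, 0),
      (cross c.turn, 0)] [(cross c.turn, 0), (cross sing, 0)] := by
    rw [turn_turn]
    refine .cons_move (L := bigon c sing) (R := bigon sing c) [(cross c.turn, 0)] 0 h
      (by rwa [move_comm])
  exact .insert hII [] 0 c.turn (turn_ne_sing hc) h'

/-! ### The elements of the six types -/

theorem RI_eq : RI = {curlMove above, curlMove below} := by
  ext m
  simp only [RI, Set.mem_ofPred_eq, Set.mem_insert_iff, Set.mem_singleton_iff, curlLeft_move, or_self]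
  constructor
  · rintro ⟨c, hc, rfl⟩
    cases c <;> simp_all
  · rintro (rfl | rfl)
    exacts [⟨above, by simp, rfl⟩, ⟨below, by simp, rfl⟩]

theorem RII_eq : RII = {bigonMove} := by
  rw [RII, bigon_move_comm below above, Set.pair_eq_singleton]

/-- The six admissible triples form two orbits of length three under `triangleMove_rotate`. -/
theorem RIII_eq : RIII = {triangleMove above above above, triangleMove below below below} := by
  have h1 := triangleMove_rotate above above above
  have h2 := triangleMove_rotate below above above
  have h3 := triangleMove_rotate below below below
  have h4 := triangleMove_rotate above below below
  ext m
  simp only [RIII, Set.mem_ofPred_eq, Set.mem_insert_iff, Set.mem_singleton_iff]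
  constructor
  · rintro ⟨x, y, z, hx, hy, hz, h, rfl⟩
    cases x <;> cases y <;> cases z <;> simp_all [turn]
  · rintro (rfl | rfl)
    exacts [⟨above, above, above, by simp⟩, ⟨below, below, below, by simp⟩]

theorem RIVO_eq : RIVO = {triangleMove above above sing} := by
  have h1 : triangleMove below sing above = _ := triangleMove_rotate above above sing
  have h2 : triangleMove sing below below = _ := triangleMove_rotate below sing above
  change ({_, triangleMove below sing above, triangleMove sing below below} : Set LocalMove) = _
  rw [h2, h1, Set.pair_eq_singleton, Set.pair_eq_singleton]

theorem RIVU_eq : RIVU = {triangleMove below below sing} := by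
  have h1 : triangleMove above sing below = _ := triangleMove_rotate below below sing
  have h2 : triangleMove sing above above = _ := triangleMove_rotate above sing below
  change ({_, triangleMove above sing below, triangleMove sing above above} : Set LocalMove) = _
  rw [h2, h1, Set.pair_eq_singleton, Set.pair_eq_singleton]

theorem RV_eq : RV = {flipMove above, flipMove below} := by
  ext m
  simp only [RV, Set.mem_ofPred_eq, Set.mem_insert_iff, Set.mem_singleton_iff]
  constructor
  · rintro ⟨c, hc, rfl⟩
    cases c <;> simp_all
  · rintro (rfl | rfl)
    exacts [⟨above, by simp, rfl⟩, ⟨below, by simp, rfl⟩]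

/-! ### The colorings which detect the moves -/

namespace Coloring

/-- The lists of `a` colors. -/
def boundaries (n : ℕ) : ℕ → List (List (Fin n))
  | 0 => [[]]
  | a + 1 => (List.finRange n).flatMap fun x => (boundaries n a).map (x :: ·)

theorem mem_boundaries {n a : ℕ} {f : List (Fin n)} : f ∈ boundaries n a ↔ f.length = a := by
  induction a generalizing f with
  | zero => simp [boundaries]
  | succ a ih =>
    cases f with
    | nil => simp [boundaries]
    | cons x f => simp [boundaries, ih]

instance {n : ℕ} (K : Coloring n) (a : ℕ) (v w : Word) : Decidable (K.Agree a v w) :=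
  decidable_of_iff (∀ f ∈ boundaries n a,
      (∀ g ∈ K.eval v f, g ∈ K.eval w f) ∧ ∀ g ∈ K.eval w f, g ∈ K.eval v f) <| by
    simp only [mem_boundaries, Agree, iff_def, forall_and]

/-- A strand changes its color whenever it passes under a strand. -/
def underParity : Coloring 2 where
  out
    | above, x, y => [(y + 1, x)]
    | below, x, y => [(y, x + 1)]
    | sing, _, _ => []
  turn c := by cases c <;> decide +kernel

/-- Strands of different colors do not meet. -/
def monochromatic : Coloring 2 where
  out
    | sing, _, _ => []
    | _, x, y => if x = y then [(x, x)] else []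
  turn c := by cases c <;> decide +kernel

/-- The effect of a strand of color `x` on the color of a strand which crosses it: the colors `3`
and `4` act on `0`, `1`, `2` by the transpositions of `0`, `1` and of `1`, `2`. -/
def permute (x y : Fin 5) : Fin 5 :=
  if x = 3 then Equiv.swap 0 1 y else if x = 4 then Equiv.swap 1 2 y else y

/-- Strands of color `3` and `4` permute the colors `0`, `1`, `2` of the strands which cross them. -/
def permuting : Coloring 5 where
  out
    | sing, _, _ => []
    | _, x, y => [(permute x y, permute y x)]
  turn c := by cases c <;> decide +kernel

/-- The effect of a strand of color `x`: the color `2` exchanges the colors `0` and `1`. -/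
def exchange (x y : Fin 3) : Fin 3 :=
  if x = 2 then Equiv.swap 0 1 y else y

/-- Strands of color `2` exchange the colors `0` and `1` of the strands below them. -/
def exchangingUnder : Coloring 3 where
  out
    | above, x, y => [(exchange x y, x)]
    | below, x, y => [(y, exchange y x)]
    | sing, x, y => if x = 0 ∧ y = 0 then [(0, 0)] else []
  turn c := by cases c <;> decide +kernel

/-- Strands of color `2` exchange the colors `0` and `1` of the strands above them. -/
def exchangingOver : Coloring 3 where
  out
    | above, x, y => [(y, exchange y x)]
    | below, x, y => [(exchange x y, x)]
    | sing, x, y => if x = 0 ∧ y = 0 then [(0, 0)] else []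
  turn c := by cases c <;> decide +kernel

/-- The colors around a singular crossing are `0`, `0`, `1`, `2` in this cyclic order. -/
def cyclic : Coloring 3 where
  out
    | sing, 1, 2 => [(0, 0)]
    | sing, 0, 1 => [(0, 2)]
    | sing, 0, 0 => [(2, 1)]
    | sing, 2, 0 => [(1, 0)]
    | sing, _, _ => []
    | _, x, y => [(y, x)]
  turn c := by cases c <;> decide +kernel

/-- Ordinary crossings are smoothed in such a way that the two arcs have different colors. -/
def smoothing : Coloring 2 where
  out
    | above, x, y => if x = y then [] else [(x, y)]
    | below, x, y => if x = y then [(x + 1, x + 1)] else []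
    | sing, x, y => if x = 0 ∧ y = 0 then [(0, 0)] else []
  turn c := by cases c <;> decide +kernel

/-- As `smoothing`, but four ends of color `0` are also allowed at an ordinary crossing. -/
def smoothingZero : Coloring 2 where
  out
    | above, x, y => if x = y then if x = 0 then [(0, 0)] else [] else [(x, y)]
    | below, x, y => if x = y then if x = 0 then [(0, 0), (1, 1)] else [(0, 0)] else []
    | sing, _, _ => []
  turn c := by cases c <;> decide +kernel

end Coloring

/-! ### Telling the moves apart -/

open Coloring

/-- The six types of moves. -/
def types : Fin 6 → Set LocalMove := ![RI, RII, RIII, RIVO, RIVU, RV]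

/-- The colorings which detect the six types of moves. -/
def detector : Fin 6 → LocalMove → Prop :=
  ![underParity.Respects, monochromatic.Respects, permuting.Respects, exchangingUnder.Respects,
    exchangingOver.Respects, cyclic.Respects]

/-- `underParity`: a curl passes under itself once, whereas types II and III preserve the parity of
underpasses of each strand. `monochromatic`: a bigon forces equal colors on strands that were
independent. `permuting`: in type III a strand meets those of colors 3 and 4 in opposite orders, and
their transpositions do not commute. These three forbid singular crossings, so the types IV and V
have no colorings on either side. `exchangingUnder`: the color at a singular crossing is 0, so
moving a strand of color 2 over it changes which ends have color 1; a strand below meets only 0,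
which acts trivially. `exchangingOver` is its mirror image. `cyclic`: type V reverses the required
cyclic order of the four ends, and 0, 0, 1, 2 is not its own reverse. -/
theorem detector_iff (i j : Fin 6) {m : LocalMove} (hm : m ∈ types j) :
    detector i m ↔ i ≠ j := by
  have key : ∀ {n : ℕ} (K : Coloring n) (j : Fin 6) (p : Fin 6 → Prop) (hm : m ∈ types j),
    (K.Agree 1 (vertical 1).word (curlRight above).word ↔ p 0) →
    (K.Agree 1 (vertical 1).word (curlRight below).word ↔ p 0) →
    (K.Agree 2 (vertical 2).word (bigon above below).word ↔ p 1) →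
    (K.Agree 3 (triangleLeft above above above).word (triangleRight above above above).word ↔ p 2) →
    (K.Agree 3 (triangleLeft below below below).word (triangleRight below below below).word ↔ p 2) →
    (K.Agree 3 (triangleLeft above above sing).word (triangleRight above above sing).word ↔ p 3) →
    (K.Agree 3 (triangleLeft below below sing).word (triangleRight below below sing).word ↔ p 4) →
    (K.Agree 2 (bigon sing above).word (bigon above sing).word ↔ p 5) →
    (K.Agree 2 (bigon sing below).word (bigon below sing).word ↔ p 5) →
    (K.Respects m ↔ p j) := by
    intro n K j p hm h0 h0' h1 h2 h2' h3 h4 h5 h5'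
    simp only [types, RI_eq, RII_eq, RIII_eq, RIVO_eq, RIVU_eq, RV_eq] at hm
    fin_cases j
    · rcases hm with rfl | rfl <;> simpa only [respects_move_iff]
    · rcases hm with rfl
      simpa only [respects_move_iff]
    · rcases hm with rfl | rfl <;> simpa only [respects_move_iff]
    · rcases hm with rfl
      simpa only [respects_move_iff]
    · rcases hm with rfl
      simpa only [respects_move_iff]
    · rcases hm with rfl | rfl <;> simpa only [respects_move_iff]
  fin_cases i
  · refine key underParity j (0 ≠ ·) hm ?_ ?_ ?_ ?_ ?_ ?_ ?_ ?_ ?_ <;> decide +kernel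
  · refine key monochromatic j (1 ≠ ·) hm ?_ ?_ ?_ ?_ ?_ ?_ ?_ ?_ ?_ <;> decide +kernel
  · refine key permuting j (2 ≠ ·) hm ?_ ?_ ?_ ?_ ?_ ?_ ?_ ?_ ?_ <;> decide +kernel
  · refine key exchangingUnder j (3 ≠ ·) hm ?_ ?_ ?_ ?_ ?_ ?_ ?_ ?_ ?_ <;> decide +kernel
  · refine key exchangingOver j (4 ≠ ·) hm ?_ ?_ ?_ ?_ ?_ ?_ ?_ ?_ ?_ <;> decide +kernel
  · refine key cyclic j (5 ≠ ·) hm ?_ ?_ ?_ ?_ ?_ ?_ ?_ ?_ ?_ <;> decide +kernel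

theorem detector_of_generatedBy (i : Fin 6) {m : LocalMove} {S : Set LocalMove}
    (hS : ∀ s ∈ S, detector i s) (h : GeneratedBy m S) : detector i m := by
  fin_cases i <;> exact Respects.of_generatedBy hS h

/-- With `above`, the curl is smoothed to a strand and a circle, whose color is then determined.
With `below`, a single arc would have to differ in color from itself. -/
theorem curlMove_ne : curlMove above ≠ curlMove below := by
  intro h
  have h1 : smoothing.Respects (curlMove above) := (respects_move_iff _).2 (by decide +kernel)
  exact absurd ((respects_move_iff _).1 (h ▸ h1)) (by decide +kernel)

/-- With `above`, both sides only forbid two adjacent ends of color 1. With `below`, the bottom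
colors 1, 1, 0 extend over the left picture only. Plain `smoothing` would not do: it has no coloring
of either side for `below`. -/
theorem triangleMove_ne : triangleMove above above above ≠ triangleMove below below below := by
  intro h
  have h1 : smoothingZero.Respects (triangleMove above above above) :=
    (respects_move_iff _).2 (by decide +kernel)
  exact absurd ((respects_move_iff _).1 (h ▸ h1)) (by decide +kernel)

/-- The singular crossing forces 0, 0. Then `above` admits nothing on either side, while `below`
puts 1, 1 at the top on one side and at the bottom on the other. -/
theorem flipMove_ne : flipMove above ≠ flipMove below := by
  intro h
  have h1 : smoothing.Respects (flipMove above) := (respects_move_iff _).2 (by decide +kernel)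
  exact absurd ((respects_move_iff _).1 (h ▸ h1)) (by decide +kernel)

/-! ### Minimal generating sets -/

theorem ncard_types (i : Fin 6) : (types i).ncard = ![2, 1, 2, 1, 1, 2] i := by
  simp only [types, RI_eq, RII_eq, RIII_eq, RIVO_eq, RIVU_eq, RV_eq]
  fin_cases i
  · exact Set.ncard_pair curlMove_ne
  · exact Set.ncard_singleton _
  · exact Set.ncard_pair triangleMove_ne
  · exact Set.ncard_singleton _
  · exact Set.ncard_singleton _
  · exact Set.ncard_pair flipMove_ne

theorem mem_allMoves {m : LocalMove} : m ∈ allMoves ↔ ∃ i, m ∈ types i := by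
  simp [allMoves, types, Fin.exists_fin_succ, or_assoc]

theorem types_unique {i j : Fin 6} {m : LocalMove} (hi : m ∈ types i) (hj : m ∈ types j) :
    i = j := by
  by_contra h
  exact (detector_iff i i hi).1 ((detector_iff i j hj).2 h) rfl

theorem IsGeneratingSet.inter_nonempty {S : Set LocalMove} (hS : IsGeneratingSet S) (i : Fin 6) :
    (S ∩ types i).Nonempty := by
  by_contra h
  obtain ⟨m, hm⟩ : (types i).Nonempty := by
    apply Set.nonempty_of_ncard_ne_zero
    rw [ncard_types]
    fin_cases i <;> simp
  refine (detector_iff i i hm).1 (detector_of_generatedBy i (fun s hs => ?_)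
    (hS.2 m (mem_allMoves.2 ⟨i, hm⟩))) rfl
  obtain ⟨j, hj⟩ := mem_allMoves.1 (hS.1 hs)
  refine (detector_iff i j hj).2 ?_
  rintro rfl
  exact h ⟨s, hs, hj⟩

theorem exists_eq_move {m : LocalMove} (hm : m ∈ allMoves) :
    ∃ (c d : ℕ) (L R : Diagram c d), m = move L R := by
  simp only [allMoves, RI_eq, RII_eq, RIII_eq, RIVO_eq, RIVU_eq, RV_eq, Set.mem_union,
    Set.mem_insert_iff, Set.mem_singleton_iff] at hm
  rcases hm with (((((rfl | rfl) | rfl) | rfl | rfl) | rfl) | rfl) | rfl | rfl <;>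
    exact ⟨_, _, _, _, rfl⟩

theorem GeneratedBy.of_mem {m : LocalMove} {S : Set LocalMove} (h : m ∈ S) : GeneratedBy m S :=
  fun _ _ _ _ hD => .single (.inr ⟨m, h, hD⟩)

theorem isGeneratingSet_of_nonempty {S : Set LocalMove} (hS : S ⊆ allMoves)
    (h : ∀ i, (S ∩ types i).Nonempty) : IsGeneratingSet S := by
  have hm : ∀ s ∈ S, ∃ (c d : ℕ) (L R : Diagram c d), s = move L R :=
    fun s hs => exists_eq_move (hS hs)
  have turn_cases : ∀ {c c' : Crossing}, c ≠ sing → c' ≠ sing → c' = c ∨ c' = c.turn := by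
    intro c c' hc hc'
    cases c <;> cases c' <;> simp_all [Crossing.turn]
  obtain ⟨c, hc, hI⟩ : ∃ c, c ≠ sing ∧ curlMove c ∈ S := by
    obtain ⟨m, hm, h⟩ := h 0
    rcases RI_eq.subset h with rfl | rfl
    exacts [⟨above, by simp, hm⟩, ⟨below, by simp, hm⟩]
  have hII : bigonMove ∈ S := by
    obtain ⟨m, hm, h⟩ := h 1
    obtain rfl := RII_eq.subset h
    exact hm
  obtain ⟨d, hd, hIII⟩ : ∃ d, d ≠ sing ∧ triangleMove d d d ∈ S := by
    obtain ⟨m, hm, h⟩ := h 2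
    rcases RIII_eq.subset h with rfl | rfl
    exacts [⟨above, by simp, hm⟩, ⟨below, by simp, hm⟩]
  obtain ⟨e, he, hV⟩ : ∃ e, e ≠ sing ∧ flipMove e ∈ S := by
    obtain ⟨m, hm, h⟩ := h 5
    rcases RV_eq.subset h with rfl | rfl
    exacts [⟨above, by simp, hm⟩, ⟨below, by simp, hm⟩]
  have gI : ∀ c', c' ≠ sing → GeneratedBy (curlMove c') S := by
    intro c' hc'
    rcases turn_cases hc hc' with rfl | rfl
    · exact .of_mem hI
    · rw [curlMove, ← curlLeft_move]
      exact (conn_curl hc hII hI).generatedBy hm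
  have gIII : ∀ d', d' ≠ sing → GeneratedBy (triangleMove d' d' d') S := by
    intro d' hd'
    rcases turn_cases hd hd' with rfl | rfl
    · exact .of_mem hIII
    · exact (conn_triangle hd hII hIII).generatedBy hm
  have gV : ∀ e', e' ≠ sing → GeneratedBy (flipMove e') S := by
    intro e' he'
    rcases turn_cases he he' with rfl | rfl
    · exact .of_mem hV
    · exact (conn_flip he hII hV).generatedBy hm
  refine ⟨hS, fun m hm => ?_⟩
  obtain ⟨i, hi⟩ := mem_allMoves.1 hm
  -- In a type with one element, the move itself lies in `S`.
  have single : ∀ {x : LocalMove}, types i = {x} → GeneratedBy m S := by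
    intro x hx
    obtain ⟨k, hk, hki⟩ := h i
    rw [hx] at hki hi
    exact .of_mem (hi ▸ hki ▸ hk)
  fin_cases i
  · rcases RI_eq.subset hi with rfl | rfl <;> exact gI _ (by simp)
  · exact single RII_eq
  · rcases RIII_eq.subset hi with rfl | rfl <;> exact gIII _ (by simp)
  · exact single RIVO_eq
  · exact single RIVU_eq
  · rcases RV_eq.subset hi with rfl | rfl <;> exact gV _ (by simp)

theorem isMinimalGeneratingSet_iff {S : Set LocalMove} :
    IsMinimalGeneratingSet S ↔ S ⊆ allMoves ∧ ∀ i, ∃! m, m ∈ S ∩ types i := by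
  constructor
  · rintro ⟨hS, hmin⟩
    refine ⟨hS.1, fun i => ?_⟩
    obtain ⟨m, hm⟩ := hS.inter_nonempty i
    refine ⟨m, hm, fun m' hm' => ?_⟩
    by_contra hne
    -- If `m` and `m'` have the same type, `m` still represents it after `m'` is removed.
    refine hmin m' hm'.1 (isGeneratingSet_of_nonempty (Set.sdiff_subset.trans hS.1) fun j => ?_)
    obtain ⟨k, hk⟩ := hS.inter_nonempty j
    by_cases hkm : k = m'
    · subst hkm
      obtain rfl := types_unique hk.2 hm'.2
      exact ⟨m, ⟨hm.1, fun h => hne h.symm⟩, hm.2⟩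
    · exact ⟨k, ⟨hk.1, hkm⟩, hk.2⟩
  · rintro ⟨hS, h⟩
    refine ⟨isGeneratingSet_of_nonempty hS fun i => (h i).exists, fun m hm hgen => ?_⟩
    obtain ⟨i, hi⟩ := mem_allMoves.1 (hS hm)
    obtain ⟨k, hk⟩ := hgen.inter_nonempty i
    exact hk.1.2 ((h i).unique ⟨hk.1.1, hk.2⟩ ⟨hm, hi⟩)

theorem ncard_isMinimalGeneratingSet :
    {S : Set LocalMove | IsMinimalGeneratingSet S}.ncard = 8 := by
  -- A minimal generating set is the range of a choice of one move per type; intersecting with the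
  -- types recovers the choice.
  let g : (∀ i, types i) → Set LocalMove := fun f => Set.range fun i => (f i : LocalMove)
  have hmem : ∀ f i, g f ∩ types i = {(f i : LocalMove)} := by
    intro f i
    ext m
    constructor
    · rintro ⟨⟨j, rfl⟩, hm⟩
      obtain rfl := types_unique (f j).2 hm
      rfl
    · rintro rfl
      exact ⟨⟨i, rfl⟩, (f i).2⟩
  have hg : Function.Injective g := by
    intro f f' h
    funext i
    have := (hmem f i).symm.trans ((congrArg (· ∩ types i) h).trans (hmem f' i))
    exact Subtype.ext (Set.singleton_injective this)
  have hr : {S | IsMinimalGeneratingSet S} = Set.range g := by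
    ext S
    simp only [Set.mem_ofPred_eq, isMinimalGeneratingSet_iff]
    constructor
    · rintro ⟨hS, h⟩
      choose f hf huniq using h
      refine ⟨fun i => ⟨f i, (hf i).2⟩, Set.Subset.antisymm ?_ fun m hm => ?_⟩
      · rintro _ ⟨i, rfl⟩
        exact (hf i).1
      · obtain ⟨i, hi⟩ := mem_allMoves.1 (hS hm)
        exact ⟨i, (huniq i m ⟨hm, hi⟩).symm⟩
    · rintro ⟨f, rfl⟩
      refine ⟨?_, fun i => ⟨f i, ?_, ?_⟩⟩
      · rintro _ ⟨i, rfl⟩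
        exact mem_allMoves.2 ⟨i, (f i).2⟩
      · rw [hmem]
        rfl
      · intro m hm
        rw [hmem] at hm
        exact hm
  rw [hr, ← Nat.card_coe_set_eq, Nat.card_range_of_injective hg, Nat.card_pi]
  simp only [Nat.card_coe_set_eq, ncard_types]
  decide

end SingularTangle

theorem theorem1p2 :
    (∀ S : Set LocalMove, IsMinimalGeneratingSet S ↔
      S ⊆ allMoves ∧
      (∃! m, m ∈ S ∩ RI) ∧ (∃! m, m ∈ S ∩ RII) ∧ (∃! m, m ∈ S ∩ RIII) ∧
      (∃! m, m ∈ S ∩ RIVO) ∧ (∃! m, m ∈ S ∩ RIVU) ∧ (∃! m, m ∈ S ∩ RV)) ∧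
    (RI.ncard = 2 ∧ RII.ncard = 1 ∧ RIII.ncard = 2 ∧
      RIVO.ncard = 1 ∧ RIVU.ncard = 1 ∧ RV.ncard = 2) ∧
    {S : Set LocalMove | IsMinimalGeneratingSet S}.ncard = 8 := by
  refine ⟨fun S => ?_, ⟨ncard_types 0, ncard_types 1, ncard_types 2, ncard_types 3,
    ncard_types 4, ncard_types 5⟩, ncard_isMinimalGeneratingSet⟩
  rw [isMinimalGeneratingSet_iff]
  refine and_congr_right fun _ => ⟨fun h => ⟨h 0, h 1, h 2, h 3, h 4, h 5⟩, ?_⟩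
  rintro ⟨h0, h1, h2, h3, h4, h5⟩ i
  fin_cases i
  exacts [h0, h1, h2, h3, h4, h5]
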